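/- For $\lambda\in\mathbb R^n$ let $\sigma_j(\lambda)$ be the $j$-th elementary symmetric function ($\sigma_0=1$ and $\sigma_j=0$ for $j>n$), for a symmetric matrix $A$ let $\sigma_j(A)=\sigma_j(\lambda(A))$, where $\lambda(A)$ is the vector of eigenvalues of $A$, and let $\Gamma_j=\{\lambda:\sigma_1(\lambda)>0,\dots,\sigma_j(\lambda)>0\}$. Put $S_k=\sigma_k+\sigma_{k-1}$ and $\tilde\Gamma_k=\Gamma_{k-1}\cap\{S_k>0\}$. A continuous function $u$ on an open set $\Omega\subset\mathbb R^n$ is a viscosity solution of $S_k(D^2u)=f$ in $\Omega$ if, for all $\varphi\in C^2(\Omega)$ and $x_0\in\Omega$: (i) $S_k(D^2\varphi(x_0))\ge f(x_0)$ whenever $u-\varphi$ has a local maximum at $x_0$; (ii) $S_k(D^2\varphi(x_0))\le f(x_0)$ whenever $u-\varphi$ has a local minimum at $x_0$ and $\lambda(D^2\varphi(x_0))\in\tilde\Gamma_k$. Write $B_r$ for the open ball of radius $r$ centred at the origin. **Theorem.** Let $n\ge 4$ and $k\ge 4$. Then there are $r>0$, a smooth function $f$ on $B_r\subset\mathbb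 R^n$ and a convex viscosity solution $u$ of $$\sigma_k(D^2u)+\sigma_{k-1}(D^2u)=f(x)\quad\text{in } B_r$$ such that $u$ is Lipschitz continuous on $B_r$, but, for some $\beta\in(0,1)$, $u\notin C^{1,\beta}(B_{r/2})$ (not even locally: it is not the case that $u$ is differentiable in $B_{r/2}$ and that $Du$ is $\beta$-Hölder continuous near each point of $B_{r/2}$). Moreover, if $k\le n+1$ (for $k>n+1$ the left-hand side of the equation is identically $0$), then this holds with $$u(x)=(1+x_1^2)\,\bigl(x_2^2+\dots+x_{k-1}^2\bigr)^{\alpha/2},\qquad \alpha=2-\frac{2}{k-1},$$ and with an $f$ that has a positive lower bound in $B_r$. -/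

import Mathlib

open scoped ContDiff

noncomputable section

namespace SumHessian

/-- The `k`-th elementary symmetric function of `v = (v₁, …, vₙ)`. It is `1` for `k = 0`
and `0` for `k > n`. -/
def sigma {n : ℕ} (k : ℕ) (v : Fin n → ℝ) : ℝ :=
  ∑ s ∈ Finset.powersetCard k (Finset.univ : Finset (Fin n)), ∏ i ∈ s, v i

/-- The sum operator `S_k = σ_k + σ_{k-1}`, for `k ≥ 1`. -/
def S {n : ℕ} (k : ℕ) (v : Fin n → ℝ) : ℝ := sigma k v + sigma (k - 1) v

/-- The Gårding cone `Γ_k`. -/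
def Gam (n k : ℕ) : Set (Fin n → ℝ) := {v | ∀ j, 1 ≤ j → j ≤ k → 0 < sigma j v}

/-- The admissible set `Γ_{k-1} ∩ {σ_k + σ_{k-1} > 0}` on which `S_k` is elliptic. -/
def GamTilde (n k : ℕ) : Set (Fin n → ℝ) := Gam n (k - 1) ∩ {v | 0 < S k v}

/-- The vector of eigenvalues, with multiplicity, of a real symmetric matrix
(and `0` for a matrix which is not symmetric). -/
def eigs {n : ℕ} (A : Matrix (Fin n) (Fin n) ℝ) : Fin n → ℝ :=
  open Classical in if h : A.IsHermitian then h.eigenvalues else 0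

/-- The Hessian matrix `D²φ(x)`, with entries `∂ᵢ∂ⱼφ(x)`. -/
def hess {n : ℕ} (φ : EuclideanSpace ℝ (Fin n) → ℝ) (x : EuclideanSpace ℝ (Fin n)) :
    Matrix (Fin n) (Fin n) ℝ :=
  Matrix.of fun i j =>
    fderiv ℝ (fderiv ℝ φ) x (EuclideanSpace.single i 1) (EuclideanSpace.single j 1)

/-- Viscosity subsolution of `S_k(D²u) = f` in the open set `Ω`: if a `C²` function `φ` touches
`u` from above at a point (up to a constant), then `S_k(D²φ) ≥ f` there. -/
def IsViscositySubsolution {n : ℕ} (k : ℕ) (Ω : Set (EuclideanSpace ℝ (Fin n)))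
    (f u : EuclideanSpace ℝ (Fin n) → ℝ) : Prop :=
  ∀ φ : EuclideanSpace ℝ (Fin n) → ℝ, ContDiffOn ℝ 2 φ Ω →
    ∀ x ∈ Ω, IsLocalMax (fun y => u y - φ y) x → f x ≤ S k (eigs (hess φ x))

/-- Viscosity supersolution of `S_k(D²u) = f` in the open set `Ω`: if a `C²` function `φ` touches
`u` from below at a point (up to a constant) and is admissible there, then `S_k(D²φ) ≤ f` there.
As always for Hessian equations, which are elliptic on admissible functions only, the test
functions from below are the admissible ones. -/
def IsViscositySupersolution {n : ℕ} (k : ℕ) (Ω : Set (EuclideanSpace ℝ (Fin n)))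
    (f u : EuclideanSpace ℝ (Fin n) → ℝ) : Prop :=
  ∀ φ : EuclideanSpace ℝ (Fin n) → ℝ, ContDiffOn ℝ 2 φ Ω →
    ∀ x ∈ Ω, IsLocalMin (fun y => u y - φ y) x → eigs (hess φ x) ∈ GamTilde n k →
      S k (eigs (hess φ x)) ≤ f x

/-- Continuous viscosity solution of `σ_k(D²u) + σ_{k-1}(D²u) = f` in the open set `Ω`. -/
structure IsViscositySolution {n : ℕ} (k : ℕ) (Ω : Set (EuclideanSpace ℝ (Fin n)))
    (f u : EuclideanSpace ℝ (Fin n) → ℝ) : Prop where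
  continuousOn : ContinuousOn u Ω
  subsolution : IsViscositySubsolution k Ω f u
  supersolution : IsViscositySupersolution k Ω f u

/-- `u ∈ C^{1,β}` locally in the open set `Ω`: `u` is differentiable in `Ω` and every point of `Ω`
has a neighbourhood on which `Du` is `β`-Hölder continuous. This class contains the functions with
finite `C^{1,β}(Ω)` norm, so that not to belong to it is the stronger assertion. -/
def IsC1Holder {n : ℕ} (β : NNReal) (Ω : Set (EuclideanSpace ℝ (Fin n)))
    (u : EuclideanSpace ℝ (Fin n) → ℝ) : Prop :=
  DifferentiableOn ℝ u Ω ∧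
    ∀ x ∈ Ω, ∃ U ∈ nhds x, ∃ C : NNReal, HolderOnWith C β (fderiv ℝ u) (U ∩ Ω)

/-- `(1 + x₁²) (x₂² + ⋯ + x_{k-1}²)^{α/2}` with `α = 2 - 2/(k-1)`. The coordinate `x_j` is
`x ⟨j - 1, _⟩`. -/
def pogorelov {n : ℕ} (hn : 0 < n) (k : ℕ) (x : EuclideanSpace ℝ (Fin n)) : ℝ :=
  (1 + x ⟨0, hn⟩ ^ 2) *
    (∑ i ∈ Finset.univ.filter (fun i : Fin n => 2 ≤ (i : ℕ) + 1 ∧ (i : ℕ) + 1 ≤ k - 1), x i ^ 2) ^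
      ((2 - 2 / ((k : ℝ) - 1)) / 2)

end SumHessian

end

/-!
Appending the entry `1` to `λ` turns `S_k` into `σ_k`, so `S_k` inherits from the Gårding cones its
monotonicity on the admissible set; this is what makes classical solutions viscosity solutions.

Off the singular set `x₂ = ⋯ = x_{k-1} = 0`, the Hessian of `u = (1 + x₁²) ρ ^ α` has only `k - 1`
nonzero rows, so `σ_k` vanishes and `σ_{k-1}` is a determinant. By homogeneity it is a function of
`x₁` times `ρ` to the power `(k - 1) α - 2 (k - 2)`, which is `0` for `α = 2 - 2 / (k - 1)`; what
remains is a smooth function of `x₁`, positive near `0`.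

On the singular set, no `C²` function touches `u` from above because `α < 2`. One touching from
below has a nonpositive Hessian along the singular set, where `u` vanishes; this leaves at most
`k - 2` positive eigenvalues, too few for it to be admissible.

Since `Du` grows like `ρ ^ (α - 1)`, it is not `β`-Hölder continuous for any `β > α - 1`.
-/

noncomputable section

namespace SumHessian

open Matrix

section SymmetricFunctions

open Polynomial

section CommSemiring

variable {R : Type*} [CommSemiring R]

lemma esymm_zero (M : Multiset R) : M.esymm 0 = 1 := by
  simp [Multiset.esymm]

lemma esymm_one (M : Multiset R) : M.esymm 1 = M.sum := by
  simp [Multiset.esymm, Multiset.powersetCard_one]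

lemma esymm_cons_succ (a : R) (M : Multiset R) (j : ℕ) :
    (a ::ₘ M).esymm (j + 1) = M.esymm (j + 1) + a * M.esymm j := by
  simp [Multiset.esymm, Multiset.powersetCard_cons, Multiset.sum_map_mul_left]

lemma esymm_eq_zero_of_card_lt {M : Multiset R} {j : ℕ} (h : M.card < j) : M.esymm j = 0 := by
  simp [Multiset.esymm, Multiset.powersetCard_eq_empty _ h]

end CommSemiring

lemma splits_derivative {p : ℝ[X]} (hp : p.Splits) : (derivative p).Splits := by
  rw [splits_iff_card_roots] at hp ⊢
  have hle := card_roots' (derivative p)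
  have hrolle := card_roots_le_derivative p
  have hdeg := natDegree_derivative_le p
  omega

lemma two_mul_coeff_zero_mul_coeff_two_le_sq {p : ℝ[X]} (hp : p.Splits) :
    2 * (p.coeff 0 * p.coeff 2) ≤ p.coeff 1 ^ 2 := by
  rw [hp.eq_prod_roots]
  induction p.roots using Multiset.induction with
  | empty => simp [coeff_C]
  | cons r M ih =>
    rw [Multiset.map_cons, Multiset.prod_cons, mul_left_comm (C p.leadingCoeff)]
    generalize C p.leadingCoeff * (M.map (X - C ·)).prod = q at ih ⊢
    have h₀ : ((X - C r) * q).coeff 0 = -r * q.coeff 0 := by simp [sub_mul]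
    have h₁ : ((X - C r) * q).coeff 1 = q.coeff 0 - r * q.coeff 1 := by
      simp [sub_mul, coeff_X_mul q 0]
    have h₂ : ((X - C r) * q).coeff 2 = q.coeff 1 - r * q.coeff 2 := by
      simp [sub_mul, coeff_X_mul q 1]
    rw [h₀, h₁, h₂]
    linarith [sq_nonneg (q.coeff 0), mul_le_mul_of_nonneg_left ih (sq_nonneg r)]

lemma add_two_mul_coeff_mul_coeff_le {p : ℝ[X]} (hp : p.Splits) (d : ℕ) :
    (d + 2) * (p.coeff d * p.coeff (d + 2)) ≤ (d + 1) * p.coeff (d + 1) ^ 2 := by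
  induction d generalizing p with
  | zero => simpa using two_mul_coeff_zero_mul_coeff_two_le_sq hp
  | succ d ih =>
    have hderiv := ih (splits_derivative hp)
    simp only [coeff_derivative] at hderiv
    push_cast at hderiv ⊢
    refine le_of_mul_le_mul_left ?_ (by positivity : (0 : ℝ) < (d + 1) * (d + 2))
    linarith

/-- Newton's inequality, without the sharp constant. -/
lemma esymm_mul_esymm_le_sq (M : Multiset ℝ) (j : ℕ) :
    M.esymm j * M.esymm (j + 2) ≤ M.esymm (j + 1) ^ 2 := by
  rcases lt_or_ge M.card (j + 2) with hcard | hcard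
  · rw [esymm_eq_zero_of_card_lt hcard, mul_zero]
    positivity
  obtain ⟨d, hd⟩ := Nat.exists_eq_add_of_le hcard
  set p : ℝ[X] := (M.map fun r => X + C r).prod
  have hp : p.Splits := Splits.multisetProd fun f hf => by
    obtain ⟨r, -, rfl⟩ := Multiset.mem_map.1 hf
    exact Splits.X_add_C r
  have hcoeff (i l : ℕ) (hil : i + l = M.card) : p.coeff i = M.esymm l := by
    rw [Multiset.prod_X_add_C_coeff _ (by omega), ← hil, Nat.add_sub_cancel_left]
  have hnewton := add_two_mul_coeff_mul_coeff_le hp d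
  rw [hcoeff d (j + 2) (by omega), hcoeff (d + 1) (j + 1) (by omega),
    hcoeff (d + 2) j (by omega)] at hnewton
  refine le_of_mul_le_mul_left ?_ (by positivity : (0 : ℝ) < d + 2)
  linarith [sq_nonneg (M.esymm (j + 1))]

/-- The Gårding cone `Γ_k`, for multisets instead of vectors: this lets one remove an entry. -/
def IsGarding (k : ℕ) (M : Multiset ℝ) : Prop := ∀ j ≤ k, 0 < M.esymm j

namespace IsGarding

variable {k : ℕ} {a b : ℝ} {M N : Multiset ℝ}

lemma of_cons (h : IsGarding (k + 1) (a ::ₘ M)) : IsGarding k M := by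
  intro j
  induction j with
  | zero => exact fun _ => esymm_zero M ▸ one_pos
  | succ j ih =>
    intro hj
    have hpos : 0 < M.esymm j := ih (by omega)
    have hcons₁ := h (j + 1) (by omega)
    have hcons₂ := h (j + 2) (by omega)
    rw [esymm_cons_succ] at hcons₁ hcons₂
    -- If `σ_{j+1}(M) ≤ 0`, then `-σ_{j+1} < a σ_j` and `-a σ_{j+1} < σ_{j+2}` contradict
    -- Newton's inequality `σ_j σ_{j+2} ≤ σ_{j+1}²`.
    by_contra! hle
    nlinarith [mul_pos hcons₂ hpos, mul_nonneg (neg_nonneg.2 hle) hcons₁.le,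
      esymm_mul_esymm_le_sq M j]

lemma esymm_cons_le (h : IsGarding k (a ::ₘ M)) (hab : a ≤ b) {j : ℕ} (hj : j ≤ k) :
    (a ::ₘ M).esymm j ≤ (b ::ₘ M).esymm j := by
  rcases j with _ | j
  · simp only [esymm_zero, le_refl]
  · obtain ⟨k, rfl⟩ := Nat.exists_eq_add_of_le' (Nat.one_le_of_lt hj)
    simp only [esymm_cons_succ]
    have := h.of_cons j (by omega)
    gcongr

lemma cons_mono (h : IsGarding k (a ::ₘ M)) (hab : a ≤ b) : IsGarding k (b ::ₘ M) :=
  fun j hj => (h j hj).trans_le (h.esymm_cons_le hab hj)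

lemma esymm_add_le (hMN : Multiset.Rel (· ≤ ·) M N) (L : Multiset ℝ)
    (h : IsGarding k (L + M)) {j : ℕ} (hj : j ≤ k) : (L + M).esymm j ≤ (L + N).esymm j := by
  induction hMN generalizing L with
  | zero => exact le_rfl
  | @cons a b M N hab _ ih =>
    rw [Multiset.add_cons] at h
    have hb := h.cons_mono hab
    rw [← Multiset.cons_add] at hb
    calc (L + a ::ₘ M).esymm j = (a ::ₘ (L + M)).esymm j := by rw [Multiset.add_cons]
      _ ≤ (b ::ₘ (L + M)).esymm j := h.esymm_cons_le hab hj
      _ = (b ::ₘ L + M).esymm j := by rw [Multiset.cons_add]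
      _ ≤ (b ::ₘ L + N).esymm j := ih _ hb
      _ = (L + b ::ₘ N).esymm j := by rw [Multiset.cons_add, Multiset.add_cons]

lemma le_card_filter_pos (h : IsGarding k M) : k ≤ (M.filter (0 < ·)).card := by
  induction k generalizing M with
  | zero => exact Nat.zero_le _
  | succ k ih =>
    obtain ⟨a, ha, hpos⟩ : ∃ a ∈ M, 0 < a := by
      by_contra! hle
      have hsum := h 1 (by omega)
      rw [esymm_one] at hsum
      exact hsum.not_ge (by simpa using Multiset.sum_le_card_nsmul M 0 hle)
    obtain ⟨M, rfl⟩ := Multiset.exists_cons_of_mem ha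
    rw [Multiset.filter_cons_of_pos _ hpos, Multiset.card_cons]
    exact Nat.succ_le_succ (ih h.of_cons)

end IsGarding

variable {n k : ℕ} {v w : Fin n → ℝ}

lemma sigma_zero (v : Fin n → ℝ) : sigma 0 v = 1 := by
  simp [sigma]

lemma sigma_eq_esymm (k : ℕ) (v : Fin n → ℝ) :
    sigma k v = (Finset.univ.val.map v).esymm k :=
  (Finset.esymm_map_val v Finset.univ k).symm

lemma sigma_eq_zero (h : n < k) (v : Fin n → ℝ) : sigma k v = 0 := by
  rw [sigma_eq_esymm, esymm_eq_zero_of_card_lt (by simpa using h)]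

lemma S_eq_zero (h : n + 1 < k) (v : Fin n → ℝ) : S k v = 0 := by
  rw [S, sigma_eq_zero (by omega), sigma_eq_zero (by omega), add_zero]

lemma S_eq_esymm_cons_one (hk : 1 ≤ k) (v : Fin n → ℝ) :
    S k v = (1 ::ₘ Finset.univ.val.map v).esymm k := by
  obtain ⟨k, rfl⟩ := Nat.exists_eq_add_of_le' hk
  rw [esymm_cons_succ, S, sigma_eq_esymm, sigma_eq_esymm, one_mul, Nat.add_sub_cancel]

lemma S_mono_of_nonneg (k : ℕ) (hv : 0 ≤ v) (hvw : v ≤ w) : S k v ≤ S k w := by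
  have hsigma (j : ℕ) : sigma j v ≤ sigma j w :=
    Finset.sum_le_sum fun s _ => Finset.prod_le_prod (fun i _ => hv i) fun i _ => hvw i
  exact add_le_add (hsigma k) (hsigma (k - 1))

lemma isGarding_of_mem_Gam (hv : v ∈ Gam n k) : IsGarding k (Finset.univ.val.map v) := by
  intro j hj
  rw [← sigma_eq_esymm]
  rcases j.eq_zero_or_pos with rfl | hpos
  · exact sigma_zero v ▸ one_pos
  · exact hv j hpos hj

lemma isGarding_cons_one_of_mem_GamTilde (hk : 1 ≤ k) (hv : v ∈ GamTilde n k) :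
    IsGarding k (1 ::ₘ Finset.univ.val.map v) := by
  have hG := isGarding_of_mem_Gam hv.1
  intro j hj
  rcases hj.lt_or_eq with hlt | rfl
  · rcases j with _ | j
    · simp only [esymm_zero, one_pos]
    · rw [esymm_cons_succ, one_mul]
      exact add_pos (hG _ (by omega)) (hG _ (by omega))
  · exact S_eq_esymm_cons_one hk v ▸ hv.2

lemma S_mono_of_mem_GamTilde (hk : 1 ≤ k) (hv : v ∈ GamTilde n k) (hvw : v ≤ w) :
    S k v ≤ S k w := by
  have hrel : Multiset.Rel (· ≤ ·) (Finset.univ.val.map v) (Finset.univ.val.map w) :=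
    Multiset.rel_map.2 (Multiset.rel_refl_of_refl_on fun i _ => hvw i)
  have hG := isGarding_cons_one_of_mem_GamTilde hk hv
  rw [← Multiset.singleton_add] at hG
  simpa only [S_eq_esymm_cons_one hk, Multiset.singleton_add]
    using IsGarding.esymm_add_le hrel {1} hG le_rfl

lemma le_card_pos_of_mem_Gam (hv : v ∈ Gam n k) :
    k ≤ (Finset.univ.filter fun i => 0 < v i).card := by
  have hcard := (isGarding_of_mem_Gam hv).le_card_filter_pos
  rwa [Multiset.filter_map, Multiset.card_map] at hcard

end SymmetricFunctions

section Eigenvalues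

open scoped MatrixOrder

variable {ι : Type*} [Fintype ι]

lemma exists_ne_zero_dotProduct_eq_zero {κ : Type*} [Fintype κ]
    (hcard : Fintype.card κ < Fintype.card ι) (c : κ → ι → ℝ) :
    ∃ v : ι → ℝ, v ≠ 0 ∧ ∀ l, c l ⬝ᵥ v = 0 := by
  have hker : LinearMap.ker (Matrix.of c).mulVecLin ≠ ⊥ :=
    LinearMap.ker_ne_bot_of_finrank_lt (by simpa using hcard)
  obtain ⟨v, hv, hv₀⟩ := (Submodule.ne_bot_iff _).1 hker
  exact ⟨v, hv₀, fun l => congrFun (LinearMap.mem_ker.1 hv) l⟩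

lemma dotProduct_mulVec_mono {A B : Matrix ι ι ℝ} (hAB : A ≤ B) (v : ι → ℝ) :
    v ⬝ᵥ A *ᵥ v ≤ v ⬝ᵥ B *ᵥ v := by
  have hnonneg := (Matrix.le_iff.1 hAB).dotProduct_mulVec_nonneg v
  rwa [star_trivial, sub_mulVec, dotProduct_sub, sub_nonneg] at hnonneg

lemma le_of_forall_dotProduct_mulVec_le {A B : Matrix ι ι ℝ} (hA : A.IsHermitian)
    (hB : B.IsHermitian) (h : ∀ v : ι → ℝ, v ⬝ᵥ A *ᵥ v ≤ v ⬝ᵥ B *ᵥ v) : A ≤ B := by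
  refine Matrix.le_iff.2 (.of_dotProduct_mulVec_nonneg (hB.sub hA) fun v => ?_)
  rw [star_trivial, sub_mulVec, dotProduct_sub, sub_nonneg]
  exact h v

lemma dotProduct_self_eq_sum_sq (b : OrthonormalBasis ι ℝ (EuclideanSpace ℝ ι)) (v : ι → ℝ) :
    v ⬝ᵥ v = ∑ i, ((b i).ofLp ⬝ᵥ v) ^ 2 := by
  have hparseval := b.sum_inner_mul_inner (WithLp.toLp 2 v) (WithLp.toLp 2 v)
  simp only [EuclideanSpace.inner_eq_star_dotProduct, star_trivial] at hparseval
  simp only [← hparseval, dotProduct_comm v, sq]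

variable [DecidableEq ι] {A B : Matrix ι ι ℝ}

lemma dotProduct_mulVec_eq_sum_eigenvalues (hA : A.IsHermitian) (v : ι → ℝ) :
    v ⬝ᵥ A *ᵥ v = ∑ i, hA.eigenvalues i * ((hA.eigenvectorBasis i).ofLp ⬝ᵥ v) ^ 2 := by
  have hparseval := hA.eigenvectorBasis.sum_inner_mul_inner (WithLp.toLp 2 v)
    (WithLp.toLp 2 (A *ᵥ v))
  simp only [EuclideanSpace.inner_eq_star_dotProduct, star_trivial] at hparseval
  have hsymm : Aᵀ = A := (by simpa using hA : A.IsSymm).eq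
  have heigen (i : ι) : A *ᵥ v ⬝ᵥ (hA.eigenvectorBasis i).ofLp =
      hA.eigenvalues i * ((hA.eigenvectorBasis i).ofLp ⬝ᵥ v) := by
    rw [dotProduct_comm, dotProduct_mulVec, ← mulVec_transpose, hsymm,
      hA.mulVec_eigenvectorBasis, smul_dotProduct, smul_eq_mul]
  rw [dotProduct_comm, ← hparseval]
  exact Finset.sum_congr rfl fun i _ => by rw [heigen]; ring

lemma dotProduct_mulVec_le_mul (hA : A.IsHermitian) {c : ℝ} {v : ι → ℝ}
    (hv : ∀ i, c < hA.eigenvalues i → (hA.eigenvectorBasis i).ofLp ⬝ᵥ v = 0) :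
    v ⬝ᵥ A *ᵥ v ≤ c * (v ⬝ᵥ v) := by
  rw [dotProduct_mulVec_eq_sum_eigenvalues hA, dotProduct_self_eq_sum_sq hA.eigenvectorBasis,
    Finset.mul_sum]
  refine Finset.sum_le_sum fun i _ => ?_
  rcases lt_or_ge c (hA.eigenvalues i) with hi | hi
  · simp [hv i hi]
  · exact mul_le_mul_of_nonneg_right hi (sq_nonneg _)

lemma mul_le_dotProduct_mulVec (hA : A.IsHermitian) {c : ℝ} {v : ι → ℝ}
    (hv : ∀ i, hA.eigenvalues i < c → (hA.eigenvectorBasis i).ofLp ⬝ᵥ v = 0) :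
    c * (v ⬝ᵥ v) ≤ v ⬝ᵥ A *ᵥ v := by
  rw [dotProduct_mulVec_eq_sum_eigenvalues hA, dotProduct_self_eq_sum_sq hA.eigenvectorBasis,
    Finset.mul_sum]
  refine Finset.sum_le_sum fun i _ => ?_
  rcases lt_or_ge (hA.eigenvalues i) c with hi | hi
  · simp [hv i hi]
  · exact mul_le_mul_of_nonneg_right hi (sq_nonneg _)

/-- Weyl's monotonicity principle. -/
lemma eigenvalues_mono (hA : A.IsHermitian) (hB : B.IsHermitian) (hAB : A ≤ B) :
    hA.eigenvalues ≤ hB.eigenvalues := by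
  intro j
  by_contra! hlt
  -- `eigenvalues` lists the decreasing sequence `eigenvalues₀` along this equivalence.
  let e := (Fintype.equivOfCardEq (Fintype.card_fin (Fintype.card ι)) : Fin _ ≃ ι).symm
  have hanti {C : Matrix ι ι ℝ} (hC : C.IsHermitian) {i l : ι} (hil : e i ≤ e l) :
      hC.eigenvalues l ≤ hC.eigenvalues i := hC.eigenvalues₀_antitone hil
  obtain ⟨v, hv₀, hv⟩ := exists_ne_zero_dotProduct_eq_zero (κ := {i : ι // i ≠ j})
    (Fintype.card_subtype_lt (x := j) (not_not.2 rfl))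
    fun i => if e j < e i then (hA.eigenvectorBasis i).ofLp else (hB.eigenvectorBasis i).ofLp
  have hA_ge : hA.eigenvalues j * (v ⬝ᵥ v) ≤ v ⬝ᵥ A *ᵥ v := by
    refine mul_le_dotProduct_mulVec hA fun i hi => ?_
    have hji : e j < e i := lt_of_not_ge fun hle => hi.not_ge (hanti hA hle)
    simpa [hji] using hv ⟨i, fun hij => hi.ne (by rw [hij])⟩
  have hB_le : v ⬝ᵥ B *ᵥ v ≤ hB.eigenvalues j * (v ⬝ᵥ v) := by
    refine dotProduct_mulVec_le_mul hB fun i hi => ?_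
    have hij : e i < e j := lt_of_not_ge fun hle => hi.not_ge (hanti hB hle)
    simpa [hij.not_gt] using hv ⟨i, fun hij => hi.ne' (by rw [hij])⟩
  have hpos : 0 < v ⬝ᵥ v := by simpa using dotProduct_star_self_pos_iff.2 hv₀
  have := mul_lt_mul_of_pos_right hlt hpos
  linarith [dotProduct_mulVec_mono hAB v]

lemma card_eigenvalues_pos_le (hA : A.IsHermitian) (T : Finset ι)
    (hT : ∀ v : ι → ℝ, (∀ i ∈ T, v i = 0) → v ⬝ᵥ A *ᵥ v ≤ 0) :
    (Finset.univ.filter fun i => 0 < hA.eigenvalues i).card ≤ T.card := by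
  set P := Finset.univ.filter fun i => 0 < hA.eigenvalues i
  by_contra! hlt
  obtain ⟨m, hmP, hmin⟩ := P.exists_min_image hA.eigenvalues (Finset.card_pos.1 (by omega))
  have hm : 0 < hA.eigenvalues m := (Finset.mem_filter.1 hmP).2
  obtain ⟨v, hv₀, hv⟩ := exists_ne_zero_dotProduct_eq_zero (κ := T ⊕ ↥Pᶜ)
    (by
      have := P.card_le_univ
      rw [Fintype.card_sum, Fintype.card_coe, Fintype.card_coe, P.card_compl]
      omega)
    (Sum.elim (fun i => Pi.single i.1 1) fun i => (hA.eigenvectorBasis i.1).ofLp)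
  have hpos : 0 < v ⬝ᵥ v := by simpa using dotProduct_star_self_pos_iff.2 hv₀
  have hge : hA.eigenvalues m * (v ⬝ᵥ v) ≤ v ⬝ᵥ A *ᵥ v :=
    mul_le_dotProduct_mulVec hA fun i hi =>
      hv (.inr ⟨i, Finset.mem_compl.2 fun hiP => hi.not_ge (hmin i hiP)⟩)
  have hle : v ⬝ᵥ A *ᵥ v ≤ 0 := hT v fun i hi => by simpa using hv (.inl ⟨i, hi⟩)
  exact (mul_pos hm hpos).not_ge (hge.trans hle)

end Eigenvalues

section Eigs

open scoped MatrixOrder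

variable {n : ℕ} {A B : Matrix (Fin n) (Fin n) ℝ}

lemma eigs_eq (hA : A.IsHermitian) : eigs A = hA.eigenvalues := dif_pos hA

lemma eigs_mono (hA : A.IsHermitian) (hB : B.IsHermitian) (hAB : A ≤ B) : eigs A ≤ eigs B := by
  rw [eigs_eq hA, eigs_eq hB]
  exact eigenvalues_mono hA hB hAB

lemma eigs_nonneg (hA : 0 ≤ A) : 0 ≤ eigs A := by
  have hpsd := Matrix.nonneg_iff_posSemidef.1 hA
  rw [eigs_eq hpsd.1]
  exact hpsd.eigenvalues_nonneg

end Eigs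

section Minors

variable {n : ℕ} {A : Matrix (Fin n) (Fin n) ℝ}

lemma sigma_eigs_eq_sum_minors (hA : A.IsHermitian) (j : ℕ) :
    sigma j (eigs A) = ∑ s ∈ Finset.powersetCard j Finset.univ,
      (A.submatrix (Subtype.val : s → Fin n) (Subtype.val : s → Fin n)).det := by
  rcases lt_or_ge n j with hlt | hj
  · rw [sigma_eq_zero hlt, Finset.powersetCard_eq_empty.2 (by simpa using hlt), Finset.sum_empty]
  have hminors := Matrix.charpoly_coeff_eq_sum_minors A j (by simpa using hj)
  rw [Polynomial.coeff_eq_esymm_roots_of_card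
    (by rw [hA.roots_charpoly_eq_eigenvalues, A.charpoly_natDegree_eq_dim]; simp)
    (by rw [A.charpoly_natDegree_eq_dim]; omega), hA.roots_charpoly_eq_eigenvalues,
    A.charpoly_monic.leadingCoeff, A.charpoly_natDegree_eq_dim, Fintype.card_fin,
    Nat.sub_sub_self hj, one_mul] at hminors
  rw [sigma_eq_esymm, eigs_eq hA]
  exact mul_left_cancel₀ (pow_ne_zero j (by norm_num)) hminors

variable {κ : Type*} [Fintype κ]

lemma sigma_eigs_eq_zero (hA : A.IsHermitian) (e : κ ↪ Fin n)
    (hrow : ∀ i ∉ Set.range e, ∀ j, A i j = 0) {j : ℕ} (hj : Fintype.card κ < j) :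
    sigma j (eigs A) = 0 := by
  rw [sigma_eigs_eq_sum_minors hA]
  refine Finset.sum_eq_zero fun s hs => ?_
  obtain ⟨i, his, hi⟩ : ∃ i ∈ s, i ∉ Finset.univ.map e := by
    refine Finset.exists_mem_notMem_of_card_lt_card ?_
    rwa [Finset.card_map, (Finset.mem_powersetCard.1 hs).2]
  refine det_eq_zero_of_row_eq_zero ⟨i, his⟩ fun j => hrow i (fun ⟨l, hl⟩ => hi ?_) j
  exact Finset.mem_map.2 ⟨l, Finset.mem_univ l, hl⟩

variable [DecidableEq κ]

lemma sigma_eigs_eq_det_submatrix (hA : A.IsHermitian) (e : κ ↪ Fin n)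
    (hrow : ∀ i ∉ Set.range e, ∀ j, A i j = 0) :
    sigma (Fintype.card κ) (eigs A) = (A.submatrix e e).det := by
  set K : Finset (Fin n) := Finset.univ.map e
  let eK : κ ≃ K := Equiv.ofBijective (fun l => ⟨e l, Finset.mem_map_of_mem e (Finset.mem_univ l)⟩)
    ⟨fun l m hlm => e.injective (congrArg Subtype.val hlm), fun ⟨i, hi⟩ => by
      obtain ⟨l, -, rfl⟩ := Finset.mem_map.1 hi
      exact ⟨l, rfl⟩⟩
  have hK : K.card = Fintype.card κ := Finset.card_map e
  rw [sigma_eigs_eq_sum_minors hA, Finset.sum_eq_single_of_mem K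
    (Finset.mem_powersetCard.2 ⟨K.subset_univ, hK⟩), ← det_submatrix_equiv_self eK]
  · rfl
  intro s hs hsK
  have hsub : ¬ s ⊆ K := fun hsub => hsK <|
    Finset.eq_of_subset_of_card_le hsub (by rw [hK, (Finset.mem_powersetCard.1 hs).2])
  obtain ⟨i, his, hiK⟩ := Finset.not_subset.1 hsub
  refine det_eq_zero_of_row_eq_zero ⟨i, his⟩ fun j => hrow i (fun ⟨l, hl⟩ => hiK ?_) j
  exact Finset.mem_map.2 ⟨l, Finset.mem_univ l, hl⟩

lemma S_eigs_eq_det_submatrix (hA : A.IsHermitian) (e : κ ↪ Fin n)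
    (hrow : ∀ i ∉ Set.range e, ∀ j, A i j = 0) :
    S (Fintype.card κ + 1) (eigs A) = (A.submatrix e e).det := by
  rw [S, sigma_eigs_eq_zero hA e hrow (Nat.lt_succ_self _), zero_add, Nat.add_sub_cancel,
    sigma_eigs_eq_det_submatrix hA e hrow]

end Minors

section AxialMatrix

variable {ι : Type*} [DecidableEq ι] {i₀ : ι} {R : Finset ι} {w : ι → ℝ}

/-- The symmetric matrix of the quadratic form `a v₀² + 2b v₀⟨w, v⟩ + c |v_R|² + d ⟨w, v⟩²`,
where `v₀ = v i₀` and `v_R` is the restriction of `v` to `R`. For `w` the restriction of `x` to `R`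
it is the shape of the Hessian at `x` of a function of `x i₀` and `|x_R|²`. -/
def axialMatrix (i₀ : ι) (R : Finset ι) (w : ι → ℝ) (a b c d : ℝ) : Matrix ι ι ℝ :=
  a • vecMulVec (Pi.single i₀ 1) (Pi.single i₀ 1) +
    b • (vecMulVec (Pi.single i₀ 1) w + vecMulVec w (Pi.single i₀ 1)) +
    c • diagonal (fun i => if i ∈ R then 1 else 0) + d • vecMulVec w w

lemma isHermitian_axialMatrix (i₀ : ι) (R : Finset ι) (w : ι → ℝ) (a b c d : ℝ) :
    (axialMatrix i₀ R w a b c d).IsHermitian := by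
  simp [axialMatrix, Matrix.IsHermitian, conjTranspose_eq_transpose_of_trivial,
    transpose_vecMulVec, add_comm]

lemma dotProduct_axialMatrix_mulVec [Fintype ι] (a b c d : ℝ) (v : ι → ℝ) :
    v ⬝ᵥ axialMatrix i₀ R w a b c d *ᵥ v =
      a * v i₀ ^ 2 + 2 * b * v i₀ * (w ⬝ᵥ v) + c * ∑ i ∈ R, v i ^ 2 + d * (w ⬝ᵥ v) ^ 2 := by
  have hdiag : v ⬝ᵥ diagonal (fun i => if i ∈ R then (1 : ℝ) else 0) *ᵥ v = ∑ i ∈ R, v i ^ 2 := by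
    simp [dotProduct, mulVec_diagonal, sq]
  simp only [axialMatrix, add_mulVec, smul_mulVec, dotProduct_add, dotProduct_smul, hdiag,
    vecMulVec_mulVec, smul_eq_mul, single_one_dotProduct, dotProduct_single_one,
    op_smul_eq_smul, dotProduct_comm v w]
  ring

lemma det_one_add_vecMulVec [Fintype ι] (u v : ι → ℝ) :
    (1 + vecMulVec u v).det = 1 + v ⬝ᵥ u := by
  rw [vecMulVec_eq Unit, det_one_add_replicateCol_mul_replicateRow]

lemma det_fromBlocks_rank_one [Fintype ι] (w : ι → ℝ) {a c : ℝ} (b d : ℝ)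
    (ha : a ≠ 0) (hc : c ≠ 0) :
    (fromBlocks (a • (1 : Matrix Unit Unit ℝ)) (b • replicateRow Unit w) (b • replicateCol Unit w)
      (c • (1 : Matrix ι ι ℝ) + d • vecMulVec w w)).det =
      a * c ^ Fintype.card ι * (1 + (d / c - b ^ 2 / (a * c)) * (w ⬝ᵥ w)) := by
  let : Invertible (a • (1 : Matrix Unit Unit ℝ)) :=
    invertibleOfRightInverse _ (a⁻¹ • 1) (by simp [smul_smul, ha])
  have hinv : ⅟(a • (1 : Matrix Unit Unit ℝ)) = a⁻¹ • 1 := rfl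
  have hschur : c • (1 : Matrix ι ι ℝ) + d • vecMulVec w w -
      b • replicateCol Unit w * ⅟(a • (1 : Matrix Unit Unit ℝ)) * b • replicateRow Unit w =
      c • (1 + vecMulVec ((d / c - b ^ 2 / (a * c)) • w) w) := by
    rw [hinv, Matrix.smul_mul, Matrix.mul_smul, Matrix.mul_smul, Matrix.mul_one, Matrix.smul_mul,
      Matrix.smul_mul, ← vecMulVec_eq, smul_vecMulVec]
    ext i j
    simp only [Matrix.add_apply, Matrix.sub_apply, Matrix.smul_apply, smul_eq_mul]
    field_simp
    ring
  rw [det_fromBlocks₁₁, hschur, det_smul, det_smul, det_one, det_one_add_vecMulVec,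
    dotProduct_smul, smul_eq_mul]
  simp [mul_assoc]

lemma submatrix_axialMatrix (hi₀ : i₀ ∉ R) (hw : ∀ i ∉ R, w i = 0) (a b c d : ℝ) :
    (axialMatrix i₀ R w a b c d).submatrix (Sum.elim (fun _ : Unit => i₀) ((↑) : R → ι))
      (Sum.elim (fun _ : Unit => i₀) ((↑) : R → ι)) =
      fromBlocks (a • (1 : Matrix Unit Unit ℝ)) (b • replicateRow Unit fun i : R => w i)
        (b • replicateCol Unit fun i : R => w i)
        (c • (1 : Matrix R R ℝ) + d • vecMulVec (fun i : R => w i) fun i : R => w i) := by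
  have hne (i : R) : (i : ι) ≠ i₀ := fun h => hi₀ (h ▸ i.2)
  have hne' (i : R) : i₀ ≠ i := (hne i).symm
  ext (i | i) (j | j) <;>
    simp [axialMatrix, vecMulVec_apply, one_apply, diagonal_apply, hw i₀ hi₀, hi₀, hne, hne']

lemma axialMatrix_apply_eq_zero (hw : ∀ i ∉ R, w i = 0) {i : ι} (hi : i ≠ i₀) (hiR : i ∉ R)
    (a b c d : ℝ) (j : ι) : axialMatrix i₀ R w a b c d i j = 0 := by
  simp [axialMatrix, vecMulVec_apply, diagonal_apply, hw i hiR, hi, hiR]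

lemma S_eigs_axialMatrix {n : ℕ} {i₀ : Fin n} {R : Finset (Fin n)} {w : Fin n → ℝ}
    (hi₀ : i₀ ∉ R) (hw : ∀ i ∉ R, w i = 0) {a c : ℝ} (b d : ℝ) (ha : a ≠ 0) (hc : c ≠ 0) :
    S (R.card + 2) (eigs (axialMatrix i₀ R w a b c d)) =
      a * c ^ R.card * (1 + (d / c - b ^ 2 / (a * c)) * ∑ i ∈ R, w i ^ 2) := by
  let e : Unit ⊕ R ↪ Fin n := ⟨Sum.elim (fun _ => i₀) (↑), Function.Injective.sumElim
    (Function.injective_of_subsingleton _) Subtype.val_injective fun _ i h => hi₀ (h ▸ i.2)⟩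
  have hrow (i) (hi : i ∉ Set.range e) (j) : axialMatrix i₀ R w a b c d i j = 0 :=
    axialMatrix_apply_eq_zero hw (fun h => hi ⟨.inl (), h.symm⟩) (fun h => hi ⟨.inr ⟨i, h⟩, rfl⟩)
      a b c d j
  have hcard : R.card + 2 = Fintype.card (Unit ⊕ R) + 1 := by simp; omega
  rw [hcard, S_eigs_eq_det_submatrix (isHermitian_axialMatrix i₀ R w a b c d) e hrow]
  have hdot : (fun i : R => w i) ⬝ᵥ (fun i : R => w i) = ∑ i ∈ R, w i ^ 2 := by
    simp only [dotProduct, ← sq]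
    exact R.sum_coe_sort fun i => w i ^ 2
  rw [← hdot, ← Fintype.card_coe R, ← det_fromBlocks_rank_one _ b d ha hc]
  exact congrArg det (submatrix_axialMatrix hi₀ hw a b c d)

end AxialMatrix

section SecondDerivative

open scoped Topology

/-- `g` is differentiable near `t` and its derivative has derivative `c` at `t`. -/
def HasSecondDerivAt (g : ℝ → ℝ) (c t : ℝ) : Prop :=
  ∃ g' : ℝ → ℝ, (∀ᶠ s in 𝓝 t, HasDerivAt g (g' s) s) ∧ HasDerivAt g' c t

namespace HasSecondDerivAt

variable {g h : ℝ → ℝ} {c d t : ℝ}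

lemma sub (hg : HasSecondDerivAt g c t) (hh : HasSecondDerivAt h d t) :
    HasSecondDerivAt (fun s => g s - h s) (c - d) t := by
  obtain ⟨g', hg, hg'⟩ := hg
  obtain ⟨h', hh, hh'⟩ := hh
  exact ⟨fun s => g' s - h' s, by filter_upwards [hg, hh] with s hgs hhs using hgs.sub hhs,
    hg'.sub hh'⟩

lemma nonpos_of_isLocalMax (hg : HasSecondDerivAt g c t) (hmax : IsLocalMax g t) : c ≤ 0 := by
  obtain ⟨g', hg, hg'⟩ := hg
  by_contra! hc
  have hderiv : deriv g =ᶠ[𝓝 t] g' := hg.mono fun s hs => hs.deriv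
  have hderiv₂ : deriv (deriv g) t = c := by rw [hderiv.deriv_eq, hg'.deriv]
  have hmin : IsLocalMin g t := isLocalMin_of_deriv_deriv_pos (hderiv₂ ▸ hc) hmax.deriv_eq_zero
    hg.self_of_nhds.continuousAt
  have hconst : g =ᶠ[𝓝 t] fun _ => g t := by
    filter_upwards [hmin, hmax] with s hle hge using le_antisymm hge hle
  have hzero : deriv (deriv g) t = 0 := by
    rw [hconst.deriv.deriv_eq]
    simp
  exact hc.ne' (hderiv₂ ▸ hzero)

lemma le_of_isLocalMax_sub (hg : HasSecondDerivAt g c t) (hh : HasSecondDerivAt h d t)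
    (hmax : IsLocalMax (fun s => g s - h s) t) : c ≤ d :=
  sub_nonpos.1 ((hg.sub hh).nonpos_of_isLocalMax hmax)

lemma unique (hc : HasSecondDerivAt g c t) (hd : HasSecondDerivAt g d t) : c = d := by
  have hmax : IsLocalMax (fun s => g s - g s) t := by simp [IsLocalMax, IsMaxFilter]
  exact le_antisymm (hc.le_of_isLocalMax_sub hd hmax) (hd.le_of_isLocalMax_sub hc hmax)

end HasSecondDerivAt

lemma hasSecondDerivAt_const (a t : ℝ) : HasSecondDerivAt (fun _ => a) 0 t :=
  ⟨fun _ => 0, .of_forall fun s => hasDerivAt_const s a, hasDerivAt_const t 0⟩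

lemma hasSecondDerivAt_mul_sq (a t : ℝ) : HasSecondDerivAt (fun s => a * s ^ 2) (2 * a) t := by
  refine ⟨fun s => 2 * a * s, .of_forall fun s => ?_, ?_⟩
  · exact ((hasDerivAt_pow 2 s).const_mul a).congr_deriv (by simp; ring)
  · simpa using (hasDerivAt_id t).const_mul (2 * a)

lemma hasSecondDerivAt_mul_rpow {f f' g g' : ℝ → ℝ} {f'' g'' t : ℝ}
    (hf : ∀ s, HasDerivAt f (f' s) s) (hf' : HasDerivAt f' f'' t)
    (hg : ∀ s, HasDerivAt g (g' s) s) (hg' : HasDerivAt g' g'' t) (ht : 0 < g t) (q : ℝ) :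
    HasSecondDerivAt (fun s => f s * g s ^ q)
      (f'' * g t ^ q + 2 * f' t * (g' t * q * g t ^ (q - 1)) +
        f t * (g'' * q * g t ^ (q - 1) + g' t ^ 2 * q * (q - 1) * g t ^ (q - 2))) t := by
  refine ⟨fun s => f' s * g s ^ q + f s * (g' s * q * g s ^ (q - 1)), ?_, ?_⟩
  · filter_upwards [(hg t).continuousAt.eventually (lt_mem_nhds ht)] with s hs
    exact (hf s).mul ((hg s).rpow_const (.inl hs.ne'))
  · refine ((hf'.mul ((hg t).rpow_const (.inl ht.ne'))).add
      ((hf t).mul ((hg'.mul_const q).mul ((hg t).rpow_const (p := q - 1)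
        (.inl ht.ne'))))).congr_deriv ?_
    rw [show q - 1 - 1 = q - 2 by ring]
    simp only [Pi.mul_apply]
    ring

end SecondDerivative

section Lines

open scoped Topology

variable {E : Type*} [NormedAddCommGroup E] [NormedSpace ℝ E] {φ : E → ℝ} {x : E}

lemma hasDerivAt_line (x v : E) (t : ℝ) :
    HasDerivAt (fun s : ℝ => x + s • v) v t := by
  simpa using ((hasDerivAt_id t).smul_const v).const_add x

lemma tendsto_line (x v : E) :
    Filter.Tendsto (fun s : ℝ => x + s • v) (𝓝 0) (𝓝 x) := by
  simpa using (hasDerivAt_line x v 0).continuousAt.tendsto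

lemma hasDerivAt_comp_line {v : E} {t : ℝ}
    (hφ : DifferentiableAt ℝ φ (x + t • v)) :
    HasDerivAt (fun s : ℝ => φ (x + s • v)) (fderiv ℝ φ (x + t • v) v) t :=
  hφ.hasFDerivAt.comp_hasDerivAt t (hasDerivAt_line x v t)

lemma isLocalMax_comp_line (hmax : IsLocalMax φ x) (v : E) :
    IsLocalMax (fun s : ℝ => φ (x + s • v)) 0 := by
  simpa [IsLocalMax, IsMaxFilter] using (tendsto_line x v).eventually hmax

end Lines

section Hessian

open scoped MatrixOrder Topology

variable {n k : ℕ} {φ ψ : EuclideanSpace ℝ (Fin n) → ℝ} {x : EuclideanSpace ℝ (Fin n)}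

lemma isHermitian_hess (hφ : ContDiffAt ℝ 2 φ x) : (hess φ x).IsHermitian := by
  ext i j
  simpa [hess] using hφ.isSymmSndFDerivAt (by simp) (EuclideanSpace.single j 1)
    (EuclideanSpace.single i 1)

lemma dotProduct_hess_mulVec (φ : EuclideanSpace ℝ (Fin n) → ℝ) (x v : EuclideanSpace ℝ (Fin n)) :
    v.ofLp ⬝ᵥ hess φ x *ᵥ v.ofLp = fderiv ℝ (fderiv ℝ φ) x v v := by
  have hv : v = ∑ i, v i • EuclideanSpace.single i (1 : ℝ) := by
    ext j
    simp [Pi.single_apply]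
  conv_rhs => rw [hv]
  simp only [map_sum, map_smul, _root_.sum_apply, _root_.smul_apply, dotProduct, mulVec, hess,
    Matrix.of_apply, smul_eq_mul, Finset.mul_sum]
  rw [Finset.sum_comm]
  exact Finset.sum_congr rfl fun i _ => Finset.sum_congr rfl fun j _ => by ring

lemma hasDerivAt_fderiv_comp_line {v : EuclideanSpace ℝ (Fin n)} {t : ℝ}
    (hφ : ContDiffAt ℝ 2 φ (x + t • v)) :
    HasDerivAt (fun s : ℝ => fderiv ℝ φ (x + s • v) v)
      (v.ofLp ⬝ᵥ hess φ (x + t • v) *ᵥ v.ofLp) t := by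
  rw [dotProduct_hess_mulVec]
  have hfderiv : DifferentiableAt ℝ (fderiv ℝ φ) (x + t • v) :=
    (hφ.fderiv_right (m := 1) (by norm_num)).differentiableAt (by simp)
  exact (ContinuousLinearMap.apply ℝ ℝ v).hasFDerivAt.comp_hasDerivAt t
    (hfderiv.hasFDerivAt.comp_hasDerivAt t (hasDerivAt_line x v t))

lemma hasSecondDerivAt_comp_line (hφ : ContDiffAt ℝ 2 φ x) (v : EuclideanSpace ℝ (Fin n)) :
    HasSecondDerivAt (fun s => φ (x + s • v)) (v.ofLp ⬝ᵥ hess φ x *ᵥ v.ofLp) 0 := by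
  have hdiff : ∀ᶠ y in 𝓝 x, DifferentiableAt ℝ φ y :=
    (hφ.eventually (by simp)).mono fun y hy => hy.differentiableAt (by simp)
  refine ⟨fun s => fderiv ℝ φ (x + s • v) v,
    ((tendsto_line x v).eventually hdiff).mono fun s hs => hasDerivAt_comp_line hs, ?_⟩
  have hx : x + (0 : ℝ) • v = x := by simp
  have hderiv := hasDerivAt_fderiv_comp_line (v := v) (t := 0) (hx.symm ▸ hφ)
  rwa [hx] at hderiv

lemma hess_le_hess_of_isLocalMax (hφ : ContDiffAt ℝ 2 φ x) (hψ : ContDiffAt ℝ 2 ψ x)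
    (hmax : IsLocalMax (fun y => φ y - ψ y) x) : hess φ x ≤ hess ψ x :=
  le_of_forall_dotProduct_mulVec_le (isHermitian_hess hφ) (isHermitian_hess hψ) fun v =>
    (hasSecondDerivAt_comp_line hφ (WithLp.toLp 2 v)).le_of_isLocalMax_sub
      (hasSecondDerivAt_comp_line hψ (WithLp.toLp 2 v)) (isLocalMax_comp_line hmax _)

lemma S_eigs_hess_le_of_isLocalMax (k : ℕ) (hφ : ContDiffAt ℝ 2 φ x) (hψ : ContDiffAt ℝ 2 ψ x)
    (hmax : IsLocalMax (fun y => φ y - ψ y) x) (hnonneg : 0 ≤ hess φ x) :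
    S k (eigs (hess φ x)) ≤ S k (eigs (hess ψ x)) :=
  S_mono_of_nonneg k (eigs_nonneg hnonneg) <| eigs_mono (isHermitian_hess hφ)
    (isHermitian_hess hψ) (hess_le_hess_of_isLocalMax hφ hψ hmax)

lemma S_eigs_hess_le_of_isLocalMax_of_mem_GamTilde (hk : 1 ≤ k) (hφ : ContDiffAt ℝ 2 φ x)
    (hψ : ContDiffAt ℝ 2 ψ x) (hmax : IsLocalMax (fun y => φ y - ψ y) x)
    (hmem : eigs (hess φ x) ∈ GamTilde n k) :
    S k (eigs (hess φ x)) ≤ S k (eigs (hess ψ x)) :=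
  S_mono_of_mem_GamTilde hk hmem <| eigs_mono (isHermitian_hess hφ)
    (isHermitian_hess hψ) (hess_le_hess_of_isLocalMax hφ hψ hmax)

lemma convexOn_of_hess_nonneg {s : Set (EuclideanSpace ℝ (Fin n))} (hs : Convex ℝ s)
    (hφ : ∀ x ∈ s, ContDiffAt ℝ 2 φ x) (hhess : ∀ x ∈ s, 0 ≤ hess φ x) : ConvexOn ℝ s φ := by
  refine ⟨hs, fun x hx y hy a b ha hb hab => ?_⟩
  have hline (t : ℝ) (ht : t ∈ Set.Icc (0 : ℝ) 1) : x + t • (y - x) ∈ s :=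
    hs.add_smul_sub_mem hx hy ht
  have hdiff (t : ℝ) (ht : t ∈ Set.Icc (0 : ℝ) 1) :=
    hasDerivAt_comp_line ((hφ _ (hline t ht)).differentiableAt two_ne_zero)
  have hconv : ConvexOn ℝ (Set.Icc 0 1) fun t : ℝ => φ (x + t • (y - x)) := by
    refine convexOn_of_hasDerivWithinAt2_nonneg (convex_Icc 0 1)
      (fun t ht => (hdiff t ht).continuousAt.continuousWithinAt)
      (fun t ht => (hdiff t (interior_subset ht)).hasDerivWithinAt)
      (fun t ht => (hasDerivAt_fderiv_comp_line
        (hφ _ (hline t (interior_subset ht)))).hasDerivWithinAt) fun t ht => ?_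
    simpa using dotProduct_mulVec_mono (hhess _ (hline t (interior_subset ht))) (y - x).ofLp
  have hcomb : a • x + b • y = x + b • (y - x) := by
    rw [← eq_sub_iff_add_eq] at hab
    rw [hab]
    module
  simpa [hcomb] using hconv.2 (Set.left_mem_Icc.2 zero_le_one) (Set.right_mem_Icc.2 zero_le_one)
    ha hb hab

end Hessian

section AxialPower

open scoped MatrixOrder Topology

variable {n : ℕ} {i₀ i : Fin n} {R : Finset (Fin n)} {q ε : ℝ} {x : EuclideanSpace ℝ (Fin n)}

/-- Pogorelov's function with axis `x i₀`, radial variables `x i` for `i ∈ R`, and exponent `q`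
on the square of the radius. A parameter `ε > 0` makes it smooth; Pogorelov's function is the case
`ε = 0`. -/
def axialPower (i₀ : Fin n) (R : Finset (Fin n)) (q ε : ℝ) (x : EuclideanSpace ℝ (Fin n)) : ℝ :=
  (1 + x i₀ ^ 2) * (∑ i ∈ R, x i ^ 2 + ε) ^ q

lemma continuous_axialPower (hq : 0 ≤ q) (ε : ℝ) : Continuous (axialPower i₀ R q ε) :=
  Continuous.mul (by fun_prop) (Continuous.rpow_const (by fun_prop) fun _ => .inr hq)

lemma contDiffAt_axialPower {m : WithTop ℕ∞} (hx : 0 < ∑ i ∈ R, x i ^ 2 + ε) :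
    ContDiffAt ℝ m (axialPower i₀ R q ε) x :=
  ContDiffAt.mul (by fun_prop) (ContDiffAt.rpow_const_of_ne (by fun_prop) hx.ne')

lemma hasSecondDerivAt_axialPower_comp_line (hx : 0 < ∑ i ∈ R, x i ^ 2 + ε)
    (v : EuclideanSpace ℝ (Fin n)) :
    HasSecondDerivAt (fun s => axialPower i₀ R q ε (x + s • v))
      (2 * v i₀ ^ 2 * (∑ i ∈ R, x i ^ 2 + ε) ^ q +
        2 * (2 * x i₀ * v i₀) * (2 * (∑ i ∈ R, x i * v i) * q *
          (∑ i ∈ R, x i ^ 2 + ε) ^ (q - 1)) +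
        (1 + x i₀ ^ 2) * (2 * (∑ i ∈ R, v i ^ 2) * q * (∑ i ∈ R, x i ^ 2 + ε) ^ (q - 1) +
          (2 * ∑ i ∈ R, x i * v i) ^ 2 * q * (q - 1) * (∑ i ∈ R, x i ^ 2 + ε) ^ (q - 2))) 0 := by
  have hcoord (i : Fin n) (s : ℝ) : HasDerivAt (fun s => x i + s * v i) (v i) s := by
    simpa using ((hasDerivAt_id s).mul_const (v i)).const_add (x i)
  have hsq (i : Fin n) (s : ℝ) :
      HasDerivAt (fun s => (x i + s * v i) ^ 2) (2 * (x i + s * v i) * v i) s := by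
    simpa using (hcoord i s).fun_pow 2
  have hsq' (i : Fin n) :
      HasDerivAt (fun s => 2 * (x i + s * v i) * v i) (2 * v i ^ 2) 0 := by
    simpa [sq, mul_assoc] using ((hcoord i 0).const_mul 2).mul_const (v i)
  convert hasSecondDerivAt_mul_rpow (fun s => (hsq i₀ s).const_add 1) (hsq' i₀)
    (fun s => (HasDerivAt.fun_sum fun i (_ : i ∈ R) => hsq i s).add_const ε)
    (HasDerivAt.fun_sum fun i _ => hsq' i) (by simpa using hx) q using 1
  · ext s
    simp [axialPower]
  · simp only [zero_mul, add_zero, Finset.mul_sum, mul_assoc]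

lemma hess_axialPower (hx : 0 < ∑ i ∈ R, x i ^ 2 + ε) :
    hess (axialPower i₀ R q ε) x = axialMatrix i₀ R (fun i => if i ∈ R then x i else 0)
      (2 * (∑ i ∈ R, x i ^ 2 + ε) ^ q)
      (4 * x i₀ * q * (∑ i ∈ R, x i ^ 2 + ε) ^ (q - 1))
      (2 * (1 + x i₀ ^ 2) * q * (∑ i ∈ R, x i ^ 2 + ε) ^ (q - 1))
      (4 * (1 + x i₀ ^ 2) * q * (q - 1) * (∑ i ∈ R, x i ^ 2 + ε) ^ (q - 2)) := by
  have hdiff : ContDiffAt ℝ 2 (axialPower i₀ R q ε) x := contDiffAt_axialPower hx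
  have hdot (v : Fin n → ℝ) :
      (fun i => if i ∈ R then x i else 0) ⬝ᵥ v = ∑ i ∈ R, x i * v i := by
    simp [dotProduct, ite_mul]
  have hform (v : Fin n → ℝ) := (hasSecondDerivAt_comp_line hdiff (WithLp.toLp 2 v)).unique
    (hasSecondDerivAt_axialPower_comp_line hx _)
  refine le_antisymm (le_of_forall_dotProduct_mulVec_le (isHermitian_hess hdiff)
    (isHermitian_axialMatrix ..) fun v => (le_of_eq ?_)) (le_of_forall_dotProduct_mulVec_le
      (isHermitian_axialMatrix ..) (isHermitian_hess hdiff) fun v => (le_of_eq ?_))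
  all_goals
    rw [hform v, dotProduct_axialMatrix_mulVec, hdot]
    ring

lemma rpow_sub_one_eq {s : ℝ} (hs : 0 < s) (q : ℝ) : s ^ (q - 1) = s ^ (q - 2) * s := by
  rw [← Real.rpow_add_one hs.ne']
  ring_nf

lemma rpow_eq_rpow_sub_two_mul_sq {s : ℝ} (hs : 0 < s) (q : ℝ) : s ^ q = s ^ (q - 2) * s ^ 2 := by
  rw [← Real.rpow_natCast s 2, ← Real.rpow_add hs]
  norm_num

lemma axialForm_nonneg {p a b c s : ℝ} (hq : 2 / 3 ≤ q) (hp : p ^ 2 ≤ 1 / 9) (hs : 0 < s)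
    (hb : b ^ 2 ≤ s * c) :
    0 ≤ 2 * s ^ q * a ^ 2 + 2 * (4 * p * q * s ^ (q - 1)) * a * b +
      2 * (1 + p ^ 2) * q * s ^ (q - 1) * c +
      4 * (1 + p ^ 2) * q * (q - 1) * s ^ (q - 2) * b ^ 2 := by
  have : 0 ≤ 2 * (1 + p ^ 2) * q * (s * c - b ^ 2) := by
    have := sub_nonneg.2 hb
    positivity
  have hsmall : 0 ≤ (1 + p ^ 2) * (2 * q - 1) - 4 * p ^ 2 * q := by nlinarith
  calc 0 ≤ s ^ (q - 2) * (2 * (1 + p ^ 2) * q * (s * c - b ^ 2) +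
        (2 * (s * a + 2 * p * q * b) ^ 2 +
          2 * q * ((1 + p ^ 2) * (2 * q - 1) - 4 * p ^ 2 * q) * b ^ 2)) := by positivity
    _ = _ := by
      rw [rpow_eq_rpow_sub_two_mul_sq hs q, rpow_sub_one_eq hs q]
      ring

lemma hess_axialPower_nonneg (hq : 2 / 3 ≤ q) (hε : 0 ≤ ε) (hx₀ : x i₀ ^ 2 ≤ 1 / 9)
    (hx : 0 < ∑ i ∈ R, x i ^ 2 + ε) : 0 ≤ hess (axialPower i₀ R q ε) x := by
  rw [hess_axialPower hx]
  refine le_of_forall_dotProduct_mulVec_le Matrix.isHermitian_zero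
    (isHermitian_axialMatrix ..) fun v => ?_
  rw [zero_mulVec, dotProduct_zero, dotProduct_axialMatrix_mulVec]
  refine axialForm_nonneg hq hx₀ hx ?_
  calc ((fun i => if i ∈ R then x i else 0) ⬝ᵥ v) ^ 2 = (∑ i ∈ R, x i * v i) ^ 2 := by
        simp [dotProduct, ite_mul]
    _ ≤ (∑ i ∈ R, x i ^ 2) * ∑ i ∈ R, v i ^ 2 := Finset.sum_mul_sq_le_sq_mul_sq R _ v
    _ ≤ (∑ i ∈ R, x i ^ 2 + ε) * ∑ i ∈ R, v i ^ 2 := by gcongr; linarith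

lemma convexOn_axialPower {s : Set (EuclideanSpace ℝ (Fin n))} (hs : Convex ℝ s)
    (hs₀ : ∀ x ∈ s, x i₀ ^ 2 ≤ 1 / 9) (hq : 2 / 3 ≤ q) : ConvexOn ℝ s (axialPower i₀ R q 0) := by
  have hpos {ε : ℝ} (hε : 0 < ε) (x : EuclideanSpace ℝ (Fin n)) : 0 < ∑ i ∈ R, x i ^ 2 + ε := by
    positivity
  have hconv : ∀ᶠ ε in 𝓝[>] (0 : ℝ), ConvexOn ℝ s (axialPower i₀ R q ε) := by
    filter_upwards [self_mem_nhdsWithin] with ε hε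
    exact convexOn_of_hess_nonneg hs (fun x _ => contDiffAt_axialPower (hpos hε x))
      fun x hx => hess_axialPower_nonneg hq (le_of_lt hε) (hs₀ x hx) (hpos hε x)
  have hlim : Filter.Tendsto (axialPower i₀ R q) (𝓝[>] 0) (𝓝 (axialPower i₀ R q 0)) := by
    refine (Continuous.tendsto (continuous_pi fun x => ?_) 0).mono_left nhdsWithin_le_nhds
    exact continuous_const.mul (Continuous.rpow_const (by fun_prop) fun _ => .inr (by linarith))
  exact isClosed_setOfPred_convexOn.mem_of_tendsto hlim hconv

lemma apply_sq_le_of_mem_ball {r : ℝ} (hx : x ∈ Metric.ball 0 r) (i : Fin n) : x i ^ 2 ≤ r ^ 2 :=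
  sq_le_sq' (abs_le.1 ((PiLp.norm_apply_le x i).trans (mem_ball_zero_iff.1 hx).le)).1
    (abs_le.1 ((PiLp.norm_apply_le x i).trans (mem_ball_zero_iff.1 hx).le)).2

lemma convexOn_axialPower_ball (hq : 2 / 3 ≤ q) :
    ConvexOn ℝ (Metric.ball 0 (1 / 3)) (axialPower i₀ R q 0) :=
  convexOn_axialPower (convex_ball _ _)
    (fun _ hx => (apply_sq_le_of_mem_ball hx i₀).trans (by norm_num)) hq

lemma exists_lipschitzOnWith_axialPower (hq : 2 / 3 ≤ q) :
    ∃ K : NNReal, LipschitzOnWith K (axialPower i₀ R q 0) (Metric.ball 0 (1 / 4)) :=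
  (convexOn_axialPower_ball hq).exists_lipschitzOnWith_of_isBounded (by norm_num) <|
    ((isCompact_closedBall (0 : EuclideanSpace ℝ (Fin n)) (1 / 3)).image
      (continuous_axialPower (by linarith) 0)).isBounded.subset
      (Set.image_mono Metric.ball_subset_closedBall)

/-- The value of `S_k` on the Hessian of Pogorelov's function `axialPower i₀ R q 0` off its singular
set, when `k = R.card + 2` and `q = R.card / (R.card + 1)`. -/
def axialRhs (i₀ : Fin n) (R : Finset (Fin n)) (q : ℝ) (x : EuclideanSpace ℝ (Fin n)) : ℝ :=
  2 * (2 * (1 + x i₀ ^ 2) * q) ^ R.card * (2 * q - 1 - 4 * x i₀ ^ 2 * q / (1 + x i₀ ^ 2))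

lemma contDiff_axialRhs {m : WithTop ℕ∞} : ContDiff ℝ m (axialRhs i₀ R q) := by
  have hne (x : EuclideanSpace ℝ (Fin n)) : 1 + x i₀ ^ 2 ≠ 0 := by positivity
  exact ContDiff.mul (by fun_prop) (contDiff_const.sub (ContDiff.div (by fun_prop)
    (by fun_prop) hne))

lemma one_third_le_axialRhs (hq : 2 / 3 ≤ q) (hx : x i₀ ^ 2 ≤ 1 / 16) :
    1 / 3 ≤ axialRhs i₀ R q x := by
  have hpow : 1 ≤ (2 * (1 + x i₀ ^ 2) * q) ^ R.card :=
    one_le_pow₀ (by nlinarith [sq_nonneg (x i₀)])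
  have hquot : 4 * x i₀ ^ 2 * q / (1 + x i₀ ^ 2) ≤ 4 * q / 17 := by
    rw [div_le_div_iff₀ (by positivity) (by norm_num)]
    nlinarith
  rw [axialRhs]
  nlinarith

lemma S_eigs_hess_axialPower (hi₀ : i₀ ∉ R) (hq₀ : 0 < q) (hq : q * (R.card + 1) = R.card)
    (hx : 0 < ∑ i ∈ R, x i ^ 2) :
    S (R.card + 2) (eigs (hess (axialPower i₀ R q 0) x)) = axialRhs i₀ R q x := by
  have hx' : 0 < ∑ i ∈ R, x i ^ 2 + 0 := by simpa using hx
  have hsum : ∑ i ∈ R, (if i ∈ R then x i else 0) ^ 2 = ∑ i ∈ R, x i ^ 2 :=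
    Finset.sum_congr rfl fun i hi => by rw [if_pos hi]
  have hcancel : (∑ i ∈ R, x i ^ 2) ^ q * ((∑ i ∈ R, x i ^ 2) ^ (q - 1)) ^ R.card = 1 := by
    rw [← Real.rpow_mul_natCast hx.le, ← Real.rpow_add hx,
      show q + (q - 1) * R.card = 0 by linear_combination hq, Real.rpow_zero]
  rw [hess_axialPower hx', S_eigs_axialMatrix hi₀ (fun i hi => if_neg hi) _ _ (by positivity)
    (by positivity), hsum, axialRhs]
  simp only [add_zero]
  have hP : 0 < (∑ i ∈ R, x i ^ 2) ^ (q - 2) := by positivity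
  rw [rpow_eq_rpow_sub_two_mul_sq hx q, rpow_sub_one_eq hx q] at hcancel ⊢
  generalize (∑ i ∈ R, x i ^ 2) ^ (q - 2) = P at *
  generalize ∑ i ∈ R, x i ^ 2 = s at *
  have : 0 < 1 + x i₀ ^ 2 := by positivity
  have hfactor : 1 + (4 * (1 + x i₀ ^ 2) * q * (q - 1) * P / (2 * (1 + x i₀ ^ 2) * q * (P * s)) -
      (4 * x i₀ * q * (P * s)) ^ 2 / (2 * (P * s ^ 2) * (2 * (1 + x i₀ ^ 2) * q * (P * s)))) * s =
      2 * q - 1 - 4 * x i₀ ^ 2 * q / (1 + x i₀ ^ 2) := by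
    field_simp
    ring
  rw [hfactor, mul_pow _ (P * s)]
  linear_combination (2 * (2 * (1 + x i₀ ^ 2) * q) ^ R.card *
    (2 * q - 1 - 4 * x i₀ ^ 2 * q / (1 + x i₀ ^ 2))) * hcancel

lemma axialPower_line_eq_zero (hq : q ≠ 0) {v : EuclideanSpace ℝ (Fin n)}
    (hx : ∀ i ∈ R, x i = 0) (hv : ∀ i ∈ R, v i = 0) (t : ℝ) :
    axialPower i₀ R q 0 (x + t • v) = 0 := by
  have hzero : ∑ i ∈ R, (x + t • v) i ^ 2 = 0 :=
    Finset.sum_eq_zero fun i hi => by simp [hx i hi, hv i hi]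
  rw [axialPower, hzero, add_zero, Real.zero_rpow hq, mul_zero]

lemma axialPower_add_smul_single (hi₀ : i₀ ∉ R) (hi : i ∈ R) (hx : ∀ i ∈ R, x i = 0) (t : ℝ) :
    axialPower i₀ R q 0 (x + t • EuclideanSpace.single i 1) =
      (1 + x i₀ ^ 2) * (t ^ 2) ^ q := by
  have hne : i₀ ≠ i := fun h => hi₀ (h ▸ hi)
  have hsum : ∑ j ∈ R, (x + t • EuclideanSpace.single i (1 : ℝ)) j ^ 2 = t ^ 2 := by
    rw [Finset.sum_eq_single_of_mem i hi fun j hj hji => by simp [hx j hj, hji]]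
    simp [hx i hi]
  rw [axialPower, hsum]
  simp [hne]

lemma tendsto_const_mul_rpow_zero {p : ℝ} (hp : 0 < p) (C : ℝ) :
    Filter.Tendsto (fun t : ℝ => C * t ^ p) (𝓝 0) (𝓝 0) := by
  simpa [Real.zero_rpow hp.ne'] using
    (Real.continuousAt_rpow_const 0 p (.inr hp.le)).tendsto.const_mul C

lemma eventually_mul_sq_le_rpow (hq₀ : 0 < q) (hq : q < 1) (M : ℝ) :
    ∀ᶠ t : ℝ in 𝓝 0, M * t ^ 2 ≤ (t ^ 2) ^ q := by
  have hsq : Filter.Tendsto (fun t : ℝ => t ^ 2) (𝓝 0) (𝓝 0) := by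
    simpa using (continuous_pow 2).tendsto (0 : ℝ)
  filter_upwards [((tendsto_const_mul_rpow_zero (sub_pos.2 hq) M).comp hsq).eventually_lt_const
    one_pos] with t ht
  calc M * t ^ 2 = M * (t ^ 2) ^ (1 - q) * (t ^ 2) ^ q := by
        rw [mul_assoc, ← Real.rpow_add_of_nonneg (sq_nonneg t) (by linarith) hq₀.le,
          sub_add_cancel, Real.rpow_one]
    _ ≤ 1 * (t ^ 2) ^ q := by
        gcongr
        exact ht.le
    _ = (t ^ 2) ^ q := one_mul _

lemma not_isLocalMax_axialPower_sub (hi₀ : i₀ ∉ R) (hi : i ∈ R) (hq₀ : 0 < q) (hq : q < 1)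
    (hx : ∀ i ∈ R, x i = 0) {φ : EuclideanSpace ℝ (Fin n) → ℝ} (hφ : ContDiffAt ℝ 2 φ x) :
    ¬ IsLocalMax (fun y => axialPower i₀ R q 0 y - φ y) x := by
  intro hmax
  set v : EuclideanSpace ℝ (Fin n) := EuclideanSpace.single i 1
  have hφ₂ := hasSecondDerivAt_comp_line hφ v
  set c := v.ofLp ⬝ᵥ hess φ x *ᵥ v.ofLp
  have hparabola : IsLocalMax (fun t => (c + 1) / 2 * t ^ 2 - φ (x + t • v)) 0 := by
    filter_upwards [isLocalMax_comp_line hmax v, eventually_mul_sq_le_rpow hq₀ hq ((c + 1) / 2)]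
      with t ht hsmall
    simp only [v, axialPower_add_smul_single hi₀ hi hx] at ht
    have hrpow : 0 ≤ (t ^ 2) ^ q := by positivity
    have hle : (t ^ 2) ^ q ≤ (1 + x i₀ ^ 2) * (t ^ 2) ^ q :=
      le_mul_of_one_le_left hrpow (by linarith [sq_nonneg (x i₀)])
    simp only [ne_eq, OfNat.ofNat_ne_zero, not_false_eq_true, zero_pow, Real.zero_rpow hq₀.ne',
      mul_zero] at ht ⊢
    linarith
  linarith [(hasSecondDerivAt_mul_sq ((c + 1) / 2) 0).le_of_isLocalMax_sub hφ₂ hparabola]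

lemma eigs_hess_notMem_GamTilde (hq : q ≠ 0) (hx : ∀ i ∈ R, x i = 0)
    {φ : EuclideanSpace ℝ (Fin n) → ℝ} (hφ : ContDiffAt ℝ 2 φ x)
    (hmin : IsLocalMin (fun y => axialPower i₀ R q 0 y - φ y) x) :
    eigs (hess φ x) ∉ GamTilde n (R.card + 2) := by
  intro hmem
  have hmax : IsLocalMax (fun y => φ y - axialPower i₀ R q 0 y) x := by
    simpa using hmin.neg
  have hle := card_eigenvalues_pos_le (isHermitian_hess hφ) R fun v hv => by
    refine (hasSecondDerivAt_comp_line hφ (WithLp.toLp 2 v)).le_of_isLocalMax_sub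
      (hasSecondDerivAt_const 0 0) ?_
    simpa only [axialPower_line_eq_zero hq hx hv] using
      isLocalMax_comp_line hmax (WithLp.toLp 2 v)
  have hge := le_card_pos_of_mem_Gam hmem.1
  rw [eigs_eq (isHermitian_hess hφ)] at hge
  omega

lemma isViscositySolution_axialPower (hi₀ : i₀ ∉ R) (hq : 2 / 3 ≤ q)
    (hqR : q * (R.card + 1) = R.card) :
    IsViscositySolution (R.card + 2) (Metric.ball 0 (1 / 4)) (axialRhs i₀ R q)
      (axialPower i₀ R q 0) := by
  have hq₀ : 0 < q := by linarith
  have hq₁ : q < 1 := by nlinarith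
  obtain ⟨i, hi⟩ : R.Nonempty := by
    rw [Finset.nonempty_iff_ne_empty]
    rintro rfl
    norm_num at hqR
    linarith
  have hsing {x : EuclideanSpace ℝ (Fin n)} :
      (∀ i ∈ R, x i = 0) ∨ 0 < ∑ i ∈ R, x i ^ 2 := by
    refine (Finset.sum_nonneg fun i _ => sq_nonneg (x i)).eq_or_lt.imp_left fun h i hi => ?_
    simpa using (Finset.sum_eq_zero_iff_of_nonneg fun i _ => sq_nonneg (x i)).1 h.symm i hi
  refine ⟨(continuous_axialPower hq₀.le 0).continuousOn, fun φ hφ x hx hmax => ?_,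
    fun φ hφ x hx hmin hmem => ?_⟩ <;>
    have hφx : ContDiffAt ℝ 2 φ x := hφ.contDiffAt (Metric.isOpen_ball.mem_nhds hx) <;>
    obtain hzero | hpos := hsing (x := x)
  · exact absurd hmax (not_isLocalMax_axialPower_sub hi₀ hi hq₀ hq₁ hzero hφx)
  · have hpos' : 0 < ∑ i ∈ R, x i ^ 2 + 0 := by simpa using hpos
    rw [← S_eigs_hess_axialPower hi₀ hq₀ hqR hpos]
    exact S_eigs_hess_le_of_isLocalMax _ (contDiffAt_axialPower hpos') hφx hmax <|
      hess_axialPower_nonneg hq le_rfl ((apply_sq_le_of_mem_ball hx i₀).trans (by norm_num)) hpos'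
  · exact absurd hmem (eigs_hess_notMem_GamTilde hq₀.ne' hzero hφx hmin)
  · rw [← S_eigs_hess_axialPower hi₀ hq₀ hqR hpos]
    exact S_eigs_hess_le_of_isLocalMax_of_mem_GamTilde (by omega) hφx
      (contDiffAt_axialPower (by simpa using hpos)) (by simpa using hmin.neg) hmem

lemma not_isC1Holder_of_eq_rpow_on_ray {u : EuclideanSpace ℝ (Fin n) → ℝ}
    {Ω : Set (EuclideanSpace ℝ (Fin n))} {e : EuclideanSpace ℝ (Fin n)} {c p : ℝ} {β : NNReal}
    (hΩ : Ω ∈ 𝓝 x) (hmin : IsLocalMin u x) (hc : 0 < c) (hp : 0 < p) (hβ : p < β + 1)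
    (hu : ∀ t > 0, u (x + t • e) = c * t ^ p) : ¬ IsC1Holder β Ω u := by
  rintro ⟨hdiff, hholder⟩
  obtain ⟨U, hU, C, hC⟩ := hholder x (mem_of_mem_nhds hΩ)
  have hbound : ∀ᶠ t : ℝ in 𝓝[>] 0, c * p ≤ C * ‖e‖ ^ (β : ℝ) * ‖e‖ * t ^ (β + 1 - p) := by
    have hnear := (tendsto_line x e).mono_left (nhdsWithin_le_nhds (s := Set.Ioi 0))
    filter_upwards [hnear.eventually hU, hnear.eventually hΩ,
      hnear.eventually (eventually_mem_nhds_iff.2 hΩ), self_mem_nhdsWithin] with t htU htΩ htΩ' ht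
    rw [Set.mem_Ioi] at ht
    have hderiv : fderiv ℝ u (x + t • e) e = c * (p * t ^ (p - 1)) := by
      refine (hasDerivAt_comp_line (hdiff.differentiableAt htΩ')).unique ?_
      refine ((Real.hasDerivAt_rpow_const (.inl ht.ne')).const_mul c).congr_of_eventuallyEq ?_
      filter_upwards [lt_mem_nhds ht] with s hs using hu s hs
    have hdist := hC.dist_le ⟨htU, htΩ⟩ ⟨mem_of_mem_nhds hU, mem_of_mem_nhds hΩ⟩
    rw [hmin.fderiv_eq_zero, dist_zero_right, dist_self_add_left, norm_smul, Real.norm_of_nonneg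
      ht.le, Real.mul_rpow ht.le (norm_nonneg e)] at hdist
    have hpow : 0 < t ^ (p - 1) := by positivity
    refine le_of_mul_le_mul_right ?_ hpow
    calc c * p * t ^ (p - 1) = fderiv ℝ u (x + t • e) e := by rw [hderiv, mul_assoc]
      _ ≤ ‖fderiv ℝ u (x + t • e)‖ * ‖e‖ :=
        (Real.le_norm_self _).trans (ContinuousLinearMap.le_opNorm ..)
      _ ≤ C * (t ^ (β : ℝ) * ‖e‖ ^ (β : ℝ)) * ‖e‖ := by gcongr
      _ = C * ‖e‖ ^ (β : ℝ) * ‖e‖ * (t ^ (β + 1 - p) * t ^ (p - 1)) := by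
        rw [← Real.rpow_add ht, show β + 1 - p + (p - 1) = (β : ℝ) by ring]
        ring
      _ = _ := (mul_assoc _ _ _).symm
  have hlim := (tendsto_const_mul_rpow_zero (sub_pos.2 hβ)
    (C * ‖e‖ ^ (β : ℝ) * ‖e‖)).mono_left (nhdsWithin_le_nhds (s := Set.Ioi 0))
  exact (mul_pos hc hp).not_ge (ge_of_tendsto hlim hbound)

lemma not_isC1Holder_axialPower (hi₀ : i₀ ∉ R) (hR : R.Nonempty) (hq : 0 < q) {β : NNReal}
    (hβ : 2 * q < β + 1) {r : ℝ} (hr : 0 < r) :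
    ¬ IsC1Holder β (Metric.ball 0 r) (axialPower i₀ R q 0) := by
  obtain ⟨i, hi⟩ := hR
  have hnonneg (y : EuclideanSpace ℝ (Fin n)) : 0 ≤ axialPower i₀ R q 0 y := by
    unfold axialPower
    positivity
  have hmin : IsLocalMin (axialPower i₀ R q 0) 0 := by
    refine .of_forall fun y => (le_of_eq ?_).trans (hnonneg y)
    simp [axialPower, Real.zero_rpow hq.ne']
  refine not_isC1Holder_of_eq_rpow_on_ray (Metric.ball_mem_nhds 0 hr) hmin one_pos
    (by positivity) hβ (e := EuclideanSpace.single i 1) fun t ht => ?_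
  rw [axialPower_add_smul_single hi₀ hi fun _ _ => rfl, Real.rpow_mul ht.le, Real.rpow_two]
  simp

end AxialPower

section Pogorelov

variable {n k : ℕ}

/-- The indices of the coordinates `x₂, …, x_{k-1}` in `pogorelov`. -/
def radIdx (n k : ℕ) : Finset (Fin n) :=
  Finset.univ.filter fun i : Fin n => 2 ≤ (i : ℕ) + 1 ∧ (i : ℕ) + 1 ≤ k - 1

/-- Half of the exponent `α` of `pogorelov`. -/
def halfExp (k : ℕ) : ℝ := (2 - 2 / ((k : ℝ) - 1)) / 2

lemma pogorelov_eq_axialPower (hn : 0 < n) (k : ℕ) :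
    pogorelov hn k = axialPower ⟨0, hn⟩ (radIdx n k) (halfExp k) 0 := by
  ext x
  simp only [pogorelov, axialPower, radIdx, halfExp, add_zero]

lemma zero_notMem_radIdx (hn : 0 < n) (k : ℕ) : (⟨0, hn⟩ : Fin n) ∉ radIdx n k := by
  simp [radIdx]

lemma radIdx_nonempty (hn : 2 ≤ n) (hk : 3 ≤ k) : (radIdx n k).Nonempty :=
  ⟨⟨1, hn⟩, by simp [radIdx]; omega⟩

lemma card_radIdx_add_two (hk : 2 ≤ k) (hkn : k ≤ n + 1) : (radIdx n k).card + 2 = k := by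
  have hmap : (radIdx n k).map Fin.valEmbedding = Finset.Icc 1 (k - 2) := by
    ext i
    simp only [radIdx, Finset.mem_map, Finset.mem_filter, Finset.mem_univ, true_and,
      Fin.valEmbedding_apply, Finset.mem_Icc]
    constructor
    · rintro ⟨j, hj, rfl⟩
      omega
    · intro hi
      exact ⟨⟨i, by omega⟩, by simp only; omega, rfl⟩
  rw [← Finset.card_map Fin.valEmbedding, hmap, Nat.card_Icc]
  omega

lemma halfExp_mul_sub_one (hk : 2 ≤ k) : halfExp k * (k - 1) = k - 2 := by
  have hk' : (k : ℝ) - 1 ≠ 0 := by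
    have : (2 : ℝ) ≤ k := mod_cast hk
    linarith
  rw [halfExp]
  field_simp
  ring

lemma two_thirds_le_halfExp (hk : 4 ≤ k) : 2 / 3 ≤ halfExp k := by
  have hk' : (4 : ℝ) ≤ k := mod_cast hk
  have := halfExp_mul_sub_one (by omega : 2 ≤ k)
  by_contra! h
  nlinarith

lemma halfExp_lt_one (hk : 2 ≤ k) : halfExp k < 1 := by
  have hk' : (2 : ℝ) ≤ k := mod_cast hk
  have := halfExp_mul_sub_one hk
  by_contra! h
  nlinarith

lemma isViscositySolution_pogorelov (hn : 0 < n) (hk : 4 ≤ k) (hkn : k ≤ n + 1) :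
    IsViscositySolution k (Metric.ball 0 (1 / 4)) (axialRhs ⟨0, hn⟩ (radIdx n k) (halfExp k))
      (pogorelov hn k) := by
  have hcard := card_radIdx_add_two (by omega) hkn
  have hcard' : ((radIdx n k).card : ℝ) + 2 = k := mod_cast hcard
  rw [pogorelov_eq_axialPower]
  nth_rw 1 [← hcard]
  refine isViscositySolution_axialPower (zero_notMem_radIdx hn k) (two_thirds_le_halfExp hk) ?_
  linear_combination halfExp_mul_sub_one (by omega : 2 ≤ k) + (halfExp k - 1) * hcard'

lemma IsViscositySolution.zero_of_lt {Ω : Set (EuclideanSpace ℝ (Fin n))}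
    {u : EuclideanSpace ℝ (Fin n) → ℝ} (hkn : n + 1 < k) (hu : ContinuousOn u Ω) :
    IsViscositySolution k Ω 0 u :=
  ⟨hu, fun _ _ _ _ _ => (S_eq_zero hkn _).ge, fun _ _ _ _ _ _ => (S_eq_zero hkn _).le⟩

lemma exists_isViscositySolution_pogorelov (hn : 0 < n) (hk : 4 ≤ k) :
    ∃ f : EuclideanSpace ℝ (Fin n) → ℝ, ContDiff ℝ ∞ f ∧
      IsViscositySolution k (Metric.ball 0 (1 / 4)) f (pogorelov hn k) ∧
      (k ≤ n + 1 → ∀ x ∈ Metric.ball 0 (1 / 4), 1 / 3 ≤ f x) := by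
  have hq := two_thirds_le_halfExp hk
  obtain hkn | hkn := le_or_gt k (n + 1)
  · exact ⟨_, contDiff_axialRhs, isViscositySolution_pogorelov hn hk hkn, fun _ x hx =>
      one_third_le_axialRhs hq ((apply_sq_le_of_mem_ball hx _).trans (by norm_num))⟩
  · refine ⟨0, contDiff_const, .zero_of_lt hkn ?_, fun h => absurd h hkn.not_ge⟩
    rw [pogorelov_eq_axialPower]
    exact (continuous_axialPower (by linarith) 0).continuousOn

end Pogorelov

end SumHessian

end

open SumHessian in
theorem mainTheorem6_general (n k : ℕ) (hn : 2 ≤ n) (hk : 4 ≤ k) :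
    ∃ r : ℝ, 0 < r ∧ ∃ f u : EuclideanSpace ℝ (Fin n) → ℝ,
      ContDiffOn ℝ ∞ f (Metric.ball 0 r) ∧
      IsViscositySolution k (Metric.ball 0 r) f u ∧
      ConvexOn ℝ (Metric.ball 0 r) u ∧
      (∃ K : NNReal, LipschitzOnWith K u (Metric.ball 0 r)) ∧
      (∃ β : NNReal, 0 < β ∧ β < 1 ∧ ¬ IsC1Holder β (Metric.ball 0 (r / 2)) u) ∧
      (k ≤ n + 1 →
        u = pogorelov (show 0 < n by omega) k ∧
        ∃ c : ℝ, 0 < c ∧ ∀ x ∈ Metric.ball (0 : EuclideanSpace ℝ (Fin n)) r, c ≤ f x) := by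
  have hn₀ : 0 < n := by omega
  have hq := two_thirds_le_halfExp hk
  have hq₀ : 0 < halfExp k := by linarith
  have hq₁ : halfExp k < 1 := halfExp_lt_one (by omega)
  obtain ⟨f, hf, hsol, hlower⟩ := exists_isViscositySolution_pogorelov hn₀ hk
  refine ⟨1 / 4, by norm_num, f, pogorelov hn₀ k, hf.contDiffOn, hsol, ?_, ?_,
    ⟨(halfExp k).toNNReal, Real.toNNReal_pos.2 hq₀, Real.toNNReal_lt_one.2 hq₁, ?_⟩,
    fun hkn => ⟨rfl, 1 / 3, by norm_num, hlower hkn⟩⟩ <;> rw [pogorelov_eq_axialPower]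
  · exact (convexOn_axialPower_ball hq).subset (Metric.ball_subset_ball (by norm_num))
      (convex_ball _ _)
  · exact exists_lipschitzOnWith_axialPower hq
  · refine not_isC1Holder_axialPower (zero_notMem_radIdx hn₀ k)
      (radIdx_nonempty hn (by omega)) hq₀ ?_ (by norm_num)
    rw [Real.coe_toNNReal _ hq₀.le]
    linarith

theorem mainTheorem6 (n k : ℕ) (hn : 4 ≤ n) (hk : 4 ≤ k) :
    ∃ r : ℝ, 0 < r ∧ ∃ f u : EuclideanSpace ℝ (Fin n) → ℝ,
      ContDiffOn ℝ ∞ f (Metric.ball 0 r) ∧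
      SumHessian.IsViscositySolution k (Metric.ball 0 r) f u ∧
      ConvexOn ℝ (Metric.ball 0 r) u ∧
      (∃ K : NNReal, LipschitzOnWith K u (Metric.ball 0 r)) ∧
      (∃ β : NNReal, 0 < β ∧ β < 1 ∧ ¬ SumHessian.IsC1Holder β (Metric.ball 0 (r / 2)) u) ∧
      (k ≤ n + 1 →
        u = SumHessian.pogorelov (show 0 < n by omega) k ∧
        ∃ c : ℝ, 0 < c ∧ ∀ x ∈ Metric.ball (0 : EuclideanSpace ℝ (Fin n)) r, c ≤ f x) :=
  mainTheorem6_general n k (by omega) hk
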